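/- Let $\mathcal Y$ be a finite set, $\phi:\mathcal Y\to\mathbb R^d$, and for $\theta\in\mathbb R^d$ let $p_\theta(y)=\exp\{\phi(y)^\top\theta-A(\theta)\}$ with $A(\theta)=\log\sum_{y\in\mathcal Y}\exp\{\phi(y)^\top\theta\}$. Let $\theta^*\in\mathbb R^d$ be such that the Fisher information $\mathcal I=\operatorname{Cov}[\phi(y)]$, $y\sim p_{\theta^*}$, is invertible, let $u$ be a probability distribution on $\mathcal Y$, and let $0<\epsilon\le 1$. Let $(y^{(i)},o^{(i)})_{i\ge1}$ be i.i.d. with $y^{(i)}\sim p_{\theta^*}$ and, conditionally on $y^{(i)}=y$, $o^{(i)}$ drawn from the classical randomized response distribution $S(o\mid y)=\epsilon\,\mathbf 1[o=y]+(1-\epsilon)u(o)$. Put $$\beta(o)=\frac{\phi(o)-(1-\epsilon)\,\mathbb E_{y'\sim u}[\phi(y')]}{\epsilon},\qquad \hat\mu_n=\frac1n\sum_{i=1}^n\beta(o^{(i)}),$$ and let the moments-based estimator $\hat\theta_n$ be a function of $(o^{(1)},\dots,o^{(n)})$ that is a maximizer of $\theta\mapsto\hat\mu_n^\top\theta-A(\theta)$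 over $\mathbb R^d$ whenever a maximizer exists (and is arbitrary otherwise). Then, with probability tending to $1$ as $n\to\infty$, a maximizer exists and is unique, and $$\sqrt n\,(\hat\theta_n-\theta^*)\ \xrightarrow{d}\ \mathcal N(0,V),\qquad V=\mathcal I^{-1}+\mathcal I^{-1}H\,\mathcal I^{-1},$$ where $V$ is positive semidefinite and, with $y\sim p_{\theta^*}$, $y'\sim u$ and $v^{\otimes2}=vv^\top$, $$H=\frac{1-\epsilon}{\epsilon^2}\operatorname{Cov}[\phi(y')]+\frac{1-\epsilon}{\epsilon}\,\mathbb E\big[(\phi(y)-\mathbb E[\phi(y')])^{\otimes2}\big].$$ -/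

import Mathlib

open Filter Topology MeasureTheory ProbabilityTheory

namespace RandResponse

noncomputable section

variable {Y : Type*} [Fintype Y] {d : ℕ}

/-- The log-partition function `A(θ) = log ∑_y exp(φ(y)ᵀ θ)`. -/
def logPartition (φ : Y → EuclideanSpace ℝ (Fin d)) (θ : EuclideanSpace ℝ (Fin d)) : ℝ :=
  Real.log (∑ y, Real.exp (inner ℝ (φ y) θ))

/-- The exponential family `p_θ(y) = exp(φ(y)ᵀ θ - A(θ))`. -/
def expFamily (φ : Y → EuclideanSpace ℝ (Fin d)) (θ : EuclideanSpace ℝ (Fin d)) (y : Y) : ℝ :=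
  Real.exp (inner ℝ (φ y) θ - logPartition φ θ)

/-- The matrix `v^{⊗2} = v vᵀ`. -/
def outerSq (v : EuclideanSpace ℝ (Fin d)) : Matrix (Fin d) (Fin d) ℝ :=
  Matrix.of fun i j => v i * v j

/-- The expectation `E[f(y)]`, where `y` has probability mass function `p`. -/
def mean (p : Y → ℝ) (f : Y → EuclideanSpace ℝ (Fin d)) : EuclideanSpace ℝ (Fin d) :=
  ∑ y, p y • f y

/-- The covariance matrix `Cov[f(y)] = E[(f(y) - E f(y))^{⊗2}]`, where `y` has probability mass
function `p`. -/
def covMat (p : Y → ℝ) (f : Y → EuclideanSpace ℝ (Fin d)) : Matrix (Fin d) (Fin d) ℝ :=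
  ∑ y, p y • outerSq (f y - mean p f)

/-- The Fisher information matrix `Cov[φ(y)]`, `y ∼ p_θ`. -/
def fisherInfo (φ : Y → EuclideanSpace ℝ (Fin d)) (θ : EuclideanSpace ℝ (Fin d)) :
    Matrix (Fin d) (Fin d) ℝ :=
  covMat (expFamily φ θ) φ

/-- The classical randomized response supervision distribution
`S(o ∣ y) = ε 1[o = y] + (1 - ε) u(o)`. -/
def supervision [DecidableEq Y] (ε : ℝ) (u : Y → ℝ) (o y : Y) : ℝ :=
  ε * (if o = y then 1 else 0) + (1 - ε) * u o

/-- The observation function `β(o) = (φ(o) - (1 - ε) E[φ(y')]) / ε`, `y' ∼ u`. -/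
def obsFun (φ : Y → EuclideanSpace ℝ (Fin d)) (ε : ℝ) (u : Y → ℝ) (o : Y) :
    EuclideanSpace ℝ (Fin d) :=
  ε⁻¹ • (φ o - (1 - ε) • mean u φ)

/-- The estimated sufficient statistics: the average of `β` over the observed sample. -/
def muHat (φ : Y → EuclideanSpace ℝ (Fin d)) (ε : ℝ) (u : Y → ℝ) {n : ℕ} (o : Fin n → Y) :
    EuclideanSpace ℝ (Fin d) :=
  (n : ℝ)⁻¹ • ∑ i, obsFun φ ε u (o i)

/-- `θ` maximizes the moment objective `θ ↦ μᵀ θ - A(θ)` over the whole parameter space. -/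
def IsMomentMaximizer (φ : Y → EuclideanSpace ℝ (Fin d)) (μ θ : EuclideanSpace ℝ (Fin d)) : Prop :=
  ∀ θ' : EuclideanSpace ℝ (Fin d), inner ℝ μ θ' - logPartition φ θ' ≤ inner ℝ μ θ - logPartition φ θ

/-- `T` is a moments-based estimator from `n` observations: its value at a sample maximizes
`θ ↦ μ̂ᵀ θ - A(θ)` whenever there is a maximizer. (If the objective has no maximizer, which is
possible as `μ̂` need not be an attainable mean of `φ`, the value of `T` is unrestricted.) -/
def IsMomentEstimator (φ : Y → EuclideanSpace ℝ (Fin d)) (ε : ℝ) (u : Y → ℝ) (n : ℕ)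
    (T : (Fin n → Y) → EuclideanSpace ℝ (Fin d)) : Prop :=
  ∀ o : Fin n → Y, (∃ θ, IsMomentMaximizer φ (muHat φ ε u o) θ) →
    IsMomentMaximizer φ (muHat φ ε u o) (T o)

/-- The matrix `H = (1-ε)/ε² Cov[φ(y')] + (1-ε)/ε E[(φ(y) - E φ(y'))^{⊗2}]`, where `y ∼ p_θ` and
`y' ∼ u`. -/
def lossMat (φ : Y → EuclideanSpace ℝ (Fin d)) (ε : ℝ) (u : Y → ℝ)
    (θ : EuclideanSpace ℝ (Fin d)) : Matrix (Fin d) (Fin d) ℝ :=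
  ((1 - ε) / ε ^ 2) • covMat u φ +
    ((1 - ε) / ε) • ∑ y, expFamily φ θ y • outerSq (φ y - mean u φ)

/-- The matrix `I⁻¹ + I⁻¹ H I⁻¹`. -/
def asympVar (φ : Y → EuclideanSpace ℝ (Fin d)) (ε : ℝ) (u : Y → ℝ)
    (θ : EuclideanSpace ℝ (Fin d)) : Matrix (Fin d) (Fin d) ℝ :=
  (fisherInfo φ θ)⁻¹ + (fisherInfo φ θ)⁻¹ * lossMat φ ε u θ * (fisherInfo φ θ)⁻¹

end

end RandResponse

/-!
By Jensen's inequality `⟪E_θ[φ], θ' - θ⟫ ≤ A(θ') - A(θ)`, and when the Fisher information is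
invertible somewhere, equality forces `θ' = θ`; hence `θ` is the only maximizer of the moment
objective at `μ = E_θ[φ]`. The mean map `θ ↦ E_θ[φ]` has derivative `I(θ)`, so by the inverse
function theorem it has a local inverse near `E_θ*[φ]`, with derivative `I⁻¹`, and for `μ` near
`E_θ*[φ]` the unique maximizer is the value of this inverse at `μ`. An observation has the mixture
law `ε p_θ* + (1 - ε) u`, under which `β` is an unbiased estimate of `E_θ*[φ]` whose covariance is
`I + H` by the law of total variance. The central limit theorem for `μ̂` and the delta method then
give the asymptotic covariance `I⁻¹ (I + H) I⁻¹`.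
-/

namespace RandResponse

section ConvergenceInProbability

variable {ι Ω : Type*} [MeasurableSpace Ω] {P : Measure Ω} {l : Filter ι}

lemma tendsto_measure_notMem {E : Type*} [PseudoEMetricSpace E] {X : ι → Ω → E} {c : E}
    (hX : TendstoInMeasure P X l fun _ => c) {s : Set E} (hs : s ∈ 𝓝 c) :
    Tendsto (fun i => P {ω | X i ω ∉ s}) l (𝓝 0) := by
  obtain ⟨δ, hδ, hδs⟩ := EMetric.mem_nhds_iff.1 hs
  refine tendsto_of_tendsto_of_tendsto_of_le_of_le tendsto_const_nhds (hX δ hδ)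
    (fun _ => zero_le) fun i => measure_mono fun ω hω => ?_
  exact not_lt.1 fun hlt => hω (hδs (Metric.mem_eball.2 hlt))

lemma tendstoInMeasure_comp {E F : Type*} [PseudoEMetricSpace E] [PseudoEMetricSpace F]
    {X : ι → Ω → E} {c : E} {f : E → F} {b : F} (hX : TendstoInMeasure P X l fun _ => c)
    (hf : Tendsto f (𝓝 c) (𝓝 b)) :
    TendstoInMeasure P (fun i ω => f (X i ω)) l fun _ => b := by
  intro δ hδ
  simpa [Set.mem_preimage] using tendsto_measure_notMem hX (hf (Metric.eball_mem_nhds b hδ))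

lemma tendstoInMeasure_of_tendsto {E : Type*} [PseudoEMetricSpace E] {a : ι → E} {c : E}
    (ha : Tendsto a l (𝓝 c)) : TendstoInMeasure P (fun i _ => a i) l fun _ => c := by
  intro δ hδ
  refine tendsto_const_nhds.congr' ?_
  filter_upwards [ha (Metric.eball_mem_nhds c hδ)] with i hi
  simp [not_le.2 (Metric.mem_eball.1 hi)]

lemma tendstoInMeasure_of_tendsto_measure_ne {E : Type*} [PseudoEMetricSpace E]
    {X X' : ι → Ω → E} {Z : Ω → E} (hX : TendstoInMeasure P X l Z)
    (hne : Tendsto (fun i => P {ω | X' i ω ≠ X i ω}) l (𝓝 0)) : TendstoInMeasure P X' l Z := by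
  intro δ hδ
  have hsum := (hX δ hδ).add hne
  rw [add_zero] at hsum
  refine tendsto_of_tendsto_of_tendsto_of_le_of_le tendsto_const_nhds hsum (fun _ => zero_le)
    fun i => (measure_mono fun ω hω => ?_).trans (measure_union_le _ _)
  by_cases h : X' i ω = X i ω
  · exact Or.inl (by simpa only [Set.mem_ofPred_eq, h] using hω)
  · exact Or.inr h

lemma tendsto_measureReal_one [IsProbabilityMeasure P] {B : ι → Set Ω}
    (hB : Tendsto (fun i => P (B i)ᶜ) l (𝓝 0)) : Tendsto (fun i => P.real (B i)) l (𝓝 1) := by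
  have hBc : Tendsto (fun i => 1 - P.real (B i)ᶜ) l (𝓝 1) := by
    simpa [measureReal_def] using
      ((ENNReal.tendsto_toReal ENNReal.zero_ne_top).comp hB).const_sub 1
  refine tendsto_of_tendsto_of_tendsto_of_le_of_le hBc tendsto_const_nhds (fun i => ?_)
    fun i => measureReal_le_one
  have hunion := measureReal_union_le (μ := P) (B i) (B i)ᶜ
  rw [Set.union_compl_self, probReal_univ] at hunion
  linarith

end ConvergenceInProbability

section DeltaMethod

variable {ι Ω Ω' : Type*} [MeasurableSpace Ω] [MeasurableSpace Ω'] {P : Measure Ω}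
  {P' : Measure Ω'} [IsProbabilityMeasure P] [IsProbabilityMeasure P'] {l : Filter ι}

lemma tendstoInMeasure_const_of_tendstoInDistribution {E : Type*} [PseudoEMetricSpace E]
    [MeasurableSpace E] [BorelSpace E] {X : ι → Ω → E} {c : E}
    (hX : TendstoInDistribution X l (fun _ : Ω' => c) (fun _ => P) P') :
    TendstoInMeasure P X l fun _ => c := by
  intro δ hδ
  have hclosed : IsClosed {x : E | δ ≤ edist x c} :=
    isClosed_le continuous_const (by fun_prop)
  have hnull : P'.map (fun _ => c) {x : E | δ ≤ edist x c} = 0 := by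
    rw [Measure.map_apply measurable_const hclosed.measurableSet]
    simp [hδ.ne']
  have hfrontier : P'.map (fun _ => c) (frontier {x : E | δ ≤ edist x c}) = 0 :=
    measure_mono_null hclosed.frontier_subset hnull
  have h := ProbabilityMeasure.tendsto_measure_of_null_frontier_of_tendsto' hX.tendsto hfrontier
  simp only [ProbabilityMeasure.coe_mk, hnull] at h
  refine h.congr fun i => ?_
  exact Measure.map_apply_of_aemeasurable (hX.forall_aemeasurable i) hclosed.measurableSet

variable [l.IsCountablyGenerated] {E : Type*} [NormedAddCommGroup E]
  [SecondCountableTopology E] [MeasurableSpace E] [BorelSpace E]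

lemma tendstoInMeasure_norm_smul_zero {F : Type*} [NormedAddCommGroup F] [NormedSpace ℝ F]
    [SecondCountableTopology F] [MeasurableSpace F] [BorelSpace F]
    {X : ι → Ω → E} {Z : Ω' → E} {R : ι → Ω → F}
    (hX : TendstoInDistribution X l Z (fun _ => P) P') (hR : TendstoInMeasure P R l fun _ => 0)
    (hRm : ∀ i, AEMeasurable (R i) P) :
    TendstoInMeasure P (fun i ω => ‖X i ω‖ • R i ω) l fun _ => 0 := by
  refine tendstoInMeasure_const_of_tendstoInDistribution (P' := P') ?_
  simpa using hX.continuous_comp_prodMk_of_tendstoInMeasure_const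
    (g := fun p : E × F => ‖p.1‖ • p.2) (by fun_prop) hR hRm

variable [NormedSpace ℝ E]

lemma tendstoInMeasure_of_tendstoInDistribution_smul_sub {r : ι → ℝ} (hr : Tendsto r l atTop)
    {M : ι → Ω → E} {m : E} {Z : Ω' → E}
    (hM : TendstoInDistribution (fun i ω => r i • (M i ω - m)) l Z (fun _ => P) P') :
    TendstoInMeasure P M l fun _ => m := by
  have hinv : TendstoInMeasure P (fun i _ => (r i)⁻¹) l fun _ => 0 :=
    tendstoInMeasure_of_tendsto hr.inv_tendsto_atTop
  have hslutsky : TendstoInMeasure P (fun i ω => (r i)⁻¹ • r i • (M i ω - m)) l fun _ => 0 := by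
    refine tendstoInMeasure_const_of_tendstoInDistribution (P' := P') ?_
    simpa using hM.continuous_comp_prodMk_of_tendstoInMeasure_const
      (g := fun p : E × ℝ => p.2 • p.1) (by fun_prop) hinv fun _ => aemeasurable_const
  have hsub : TendstoInMeasure P (fun i ω => M i ω - m) l fun _ => 0 := by
    refine hslutsky.congr' ?_ (ae_eq_refl _)
    filter_upwards [hr.eventually_ne_atTop 0] with i hi
    exact ae_of_all _ fun ω => inv_smul_smul₀ hi _
  simpa using tendstoInMeasure_comp hsub (f := (· + m)) (Continuous.tendsto (by fun_prop) 0)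

theorem tendstoInDistribution_smul_sub_of_hasFDerivAt {F : Type*} [NormedAddCommGroup F]
    [NormedSpace ℝ F] [SecondCountableTopology F] [MeasurableSpace F] [BorelSpace F]
    {r : ι → ℝ} (hr : Tendsto r l atTop) {M : ι → Ω → E} {m : E} {Z : Ω' → E}
    (hMm : ∀ i, AEMeasurable (M i) P)
    (hM : TendstoInDistribution (fun i ω => r i • (M i ω - m)) l Z (fun _ => P) P')
    {g : E → F} {g' : E →L[ℝ] F} (hg : HasFDerivAt g g' m) {S : ι → Ω → F}
    (hSm : ∀ i, AEMeasurable (S i) P) (hS : Tendsto (fun i => P {ω | S i ω ≠ g (M i ω)}) l (𝓝 0)) :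
    TendstoInDistribution (fun i ω => r i • (S i ω - g m)) l (fun ω => g' (Z ω))
      (fun _ => P) P' := by
  have hconsistent := tendstoInMeasure_of_tendstoInDistribution_smul_sub hr hM
  -- The error `S i - g m - g' (M i - m)` is `o(‖M i - m‖)`, and `r i * ‖M i - m‖` stays tight.
  have hrem : TendstoInMeasure P
      (fun i ω => ‖M i ω - m‖⁻¹ • (S i ω - g m - g' (M i ω - m))) l fun _ => 0 := by
    have hlim : Tendsto (fun x => ‖x - m‖⁻¹ • (g x - g m - g' (x - m))) (𝓝 m) (𝓝 0) := by
      simpa [tendsto_zero_iff_norm_tendsto_zero, norm_smul] using hasFDerivAt_iff_tendsto.1 hg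
    refine tendstoInMeasure_of_tendsto_measure_ne (tendstoInMeasure_comp hconsistent hlim) ?_
    refine tendsto_of_tendsto_of_tendsto_of_le_of_le tendsto_const_nhds hS (fun _ => zero_le)
      fun i => measure_mono fun ω hω h => hω ?_
    simp only [h]
  have hrem_smul := tendstoInMeasure_norm_smul_zero hM hrem fun i => by fun_prop
  have hlinear := hM.continuous_comp g'.continuous
  refine tendstoInDistribution_of_tendstoInMeasure_sub _ _ hlinear ?_ fun i => by fun_prop
  refine tendstoInMeasure_of_tendsto_measure_ne hrem_smul ?_
  refine tendsto_of_tendsto_of_tendsto_of_le_of_le' tendsto_const_nhds hS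
    (Eventually.of_forall fun _ => zero_le) ?_
  filter_upwards [hr.eventually_ge_atTop 0] with i hi
  refine measure_mono fun ω hω hSg => hω ?_
  rcases eq_or_ne (M i ω) m with hMm | hMm
  · simp [hSg, hMm]
  · rw [norm_smul, Real.norm_of_nonneg hi, mul_smul,
      smul_inv_smul₀ (norm_ne_zero_iff.2 (sub_ne_zero.2 hMm))]
    simp [smul_sub]

end DeltaMethod

section CentralLimit

lemma charFun_map_eq_charFun_map_inner {Ω E : Type*} [MeasurableSpace Ω] {P : Measure Ω}
    [NormedAddCommGroup E] [InnerProductSpace ℝ E] [SecondCountableTopology E] [MeasurableSpace E]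
    [BorelSpace E] {X : Ω → E} (hX : AEMeasurable X P) (t : E) :
    charFun (P.map X) t = charFun (P.map fun ω => inner ℝ (X ω) t) 1 := by
  rw [charFun_apply, charFun_apply, integral_map hX (by fun_prop),
    integral_map (by fun_prop) (by fun_prop)]
  simp

variable {Ω Ω' : Type*} [MeasurableSpace Ω] [MeasurableSpace Ω'] {P : Measure Ω}
  {P' : Measure Ω'} [IsProbabilityMeasure P] [IsProbabilityMeasure P']

lemma tendstoInDistribution_id_of_map_eq {ι E : Type*} [TopologicalSpace E] [MeasurableSpace E]
    [OpensMeasurableSpace E] {X : ι → Ω → E} {l : Filter ι} {Z : Ω' → E}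
    (hX : TendstoInDistribution X l Z (fun _ => P) P') {ν : Measure E} [IsProbabilityMeasure ν]
    (hZ : P'.map Z = ν) : TendstoInDistribution X l id (fun _ => P) ν where
  forall_aemeasurable := hX.forall_aemeasurable
  tendsto := by
    subst hZ
    simpa only [Measure.map_id] using hX.tendsto

variable {E : Type*} [NormedAddCommGroup E] [InnerProductSpace ℝ E] [FiniteDimensional ℝ E]
  [MeasurableSpace E] [BorelSpace E]

theorem tendstoInDistribution_of_forall_inner {X : ℕ → Ω → E} {Z : Ω' → E}
    (hX : ∀ n, AEMeasurable (X n) P) (hZ : AEMeasurable Z P')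
    (h : ∀ t : E, TendstoInDistribution (fun n ω => inner ℝ (X n ω) t) atTop
      (fun ω => inner ℝ (Z ω) t) (fun _ => P) P') :
    TendstoInDistribution X atTop Z (fun _ => P) P' where
  forall_aemeasurable := hX
  tendsto := by
    refine ProbabilityMeasure.tendsto_iff_tendsto_charFun.2 fun t => ?_
    simp only [ProbabilityMeasure.coe_mk, charFun_map_eq_charFun_map_inner (hX _),
      charFun_map_eq_charFun_map_inner hZ]
    exact ProbabilityMeasure.tendsto_iff_tendsto_charFun.1 (h t).tendsto 1

theorem tendstoInDistribution_inv_sqrt_smul_sum_sub {X : ℕ → Ω → E} (hX : MemLp (X 0) 2 P)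
    (hindep : iIndepFun X P) (hident : ∀ i, IdentDistrib (X i) (X 0) P P) {Z : Ω' → E}
    (hZ : HasGaussianLaw Z P') (hZ0 : P'[Z] = 0)
    (hvar : ∀ t : E, Var[fun ω => inner ℝ (Z ω) t; P'] = Var[fun ω => inner ℝ (X 0 ω) t; P]) :
    TendstoInDistribution
      (fun (n : ℕ) ω => (√(n : ℝ))⁻¹ • (∑ k ∈ Finset.range n, X k ω - (n : ℝ) • P[X 0]))
      atTop Z (fun _ => P) P' := by
  have hXm : ∀ i, AEMeasurable (X i) P := fun i => (hident i).aemeasurable_fst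
  refine tendstoInDistribution_of_forall_inner (fun n => by fun_prop) hZ.aemeasurable fun t => ?_
  have hinner : Measurable fun x : E => inner ℝ x t := by fun_prop
  have hZlaw : HasLaw (fun ω => inner ℝ (Z ω) t)
      (gaussianReal 0 Var[fun ω => inner ℝ (X 0 ω) t; P].toNNReal) P' := by
    refine ⟨by have := hZ.aemeasurable; fun_prop, ?_⟩
    have hgauss : HasGaussianLaw (fun ω => inner ℝ (Z ω) t) P' := by
      simpa [real_inner_comm] using hZ.map_fun (innerSL ℝ t)
    rw [hgauss.map_eq_gaussianReal, hvar]
    simp_rw [real_inner_comm t]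
    rw [integral_inner hZ.integrable, hZ0, inner_zero_right]
  have hclt := tendstoInDistribution_inv_sqrt_mul_sum_sub
    (X := fun i ω => inner ℝ (X i ω) t) hZlaw (hX.inner_const t)
    (hindep.comp (fun _ x => inner ℝ x t) fun _ => hinner) fun i => (hident i).comp hinner
  have hmean : ∫ ω, inner ℝ (X 0 ω) t ∂P = inner ℝ (P[X 0]) t := by
    simp_rw [real_inner_comm t]
    exact integral_inner (hX.integrable one_le_two) t
  simpa [inner_smul_left, inner_sub_left, sum_inner, hmean] using hclt

end CentralLimit

theorem map_toEuclideanCLM_multivariateGaussian {κ : Type*} [Fintype κ] [DecidableEq κ]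
    (m : EuclideanSpace ℝ κ) {S : Matrix κ κ ℝ} (hS : S.PosSemidef) (A : Matrix κ κ ℝ) :
    (multivariateGaussian m S).map (Matrix.toEuclideanCLM (𝕜 := ℝ) A) =
      multivariateGaussian (Matrix.toEuclideanCLM (𝕜 := ℝ) A m) (A * S * A.transpose) := by
  have hASA : (A * S * A.transpose).PosSemidef := by
    simpa using hS.mul_mul_conjTranspose_same A
  have hadj : ∀ x t : EuclideanSpace ℝ κ, inner ℝ (Matrix.toEuclideanCLM (𝕜 := ℝ) A x) t =
      inner ℝ x (Matrix.toEuclideanCLM (𝕜 := ℝ) A.transpose t) := fun x t => by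
    rw [← ContinuousLinearMap.adjoint_inner_right, ← ContinuousLinearMap.star_eq_adjoint,
      ← map_star, Matrix.star_eq_conjTranspose, Matrix.conjTranspose_eq_transpose_of_trivial]
  refine Measure.ext_of_charFun (funext fun t => ?_)
  calc charFun ((multivariateGaussian m S).map (Matrix.toEuclideanCLM (𝕜 := ℝ) A)) t
      = charFun (multivariateGaussian m S) (Matrix.toEuclideanCLM (𝕜 := ℝ) A.transpose t) := by
        rw [charFun_apply, charFun_apply, integral_map (by fun_prop) (by fun_prop)]
        simp_rw [hadj]
    _ = charFun (multivariateGaussian (Matrix.toEuclideanCLM (𝕜 := ℝ) A m)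
          (A * S * A.transpose)) t := by
        rw [charFun_multivariateGaussian hS, charFun_multivariateGaussian hASA,
          real_inner_comm, ← hadj, real_inner_comm]
        simp only [Matrix.ofLp_toEuclideanCLM, ← Matrix.mulVec_mulVec, Matrix.dotProduct_mulVec,
          Matrix.mulVec_transpose]

lemma variance_inner_multivariateGaussian {κ : Type*} [Fintype κ] [DecidableEq κ]
    (m : EuclideanSpace ℝ κ) {S : Matrix κ κ ℝ} (hS : S.PosSemidef) (t : EuclideanSpace ℝ κ) :
    Var[fun x => inner ℝ x t; multivariateGaussian m S] =
      inner ℝ t (Matrix.toEuclideanCLM (𝕜 := ℝ) S t) := by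
  simp_rw [real_inner_comm t]
  rw [← covarianceBilin_self IsGaussian.memLp_two_id, covarianceBilin_multivariateGaussian hS,
    Matrix.inner_toEuclideanCLM]

section WeightedMoments

variable {Y : Type*} [Fintype Y] {d : ℕ} {p : Y → ℝ} {f : Y → EuclideanSpace ℝ (Fin d)}

lemma inner_mean (w : EuclideanSpace ℝ (Fin d)) :
    inner ℝ (mean p f) w = ∑ y, p y * inner ℝ (f y) w := by
  simp [mean, sum_inner, inner_smul_left]

lemma outerSq_eq_vecMulVec (v : EuclideanSpace ℝ (Fin d)) :
    outerSq v = Matrix.vecMulVec (v : Fin d → ℝ) v := rfl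

lemma toEuclideanCLM_outerSq (v w : EuclideanSpace ℝ (Fin d)) :
    Matrix.toEuclideanCLM (𝕜 := ℝ) (outerSq v) w = inner ℝ v w • v := by
  ext i
  simp [outerSq_eq_vecMulVec, Matrix.ofLp_toEuclideanCLM, Matrix.vecMulVec_mulVec,
    PiLp.inner_apply, dotProduct, mul_comm]

lemma toEuclideanCLM_covMat (w : EuclideanSpace ℝ (Fin d)) :
    Matrix.toEuclideanCLM (𝕜 := ℝ) (covMat p f) w =
      ∑ y, p y • inner ℝ (f y - mean p f) w • (f y - mean p f) := by
  simp [covMat, map_sum, map_smul, toEuclideanCLM_outerSq]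

lemma sum_mul_inner_sub_mean (hp : ∑ y, p y = 1) (w : EuclideanSpace ℝ (Fin d)) :
    ∑ y, p y * inner ℝ (f y - mean p f) w = 0 := by
  simp [inner_sub_left, mul_sub, Finset.sum_sub_distrib, ← Finset.sum_mul, hp, ← inner_mean]

lemma toEuclideanCLM_covMat_eq_sum (hp : ∑ y, p y = 1) (w : EuclideanSpace ℝ (Fin d)) :
    Matrix.toEuclideanCLM (𝕜 := ℝ) (covMat p f) w =
      ∑ y, p y • inner ℝ (f y - mean p f) w • f y := by
  simp only [toEuclideanCLM_covMat, smul_sub, smul_smul, Finset.sum_sub_distrib,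
    ← Finset.sum_smul, sum_mul_inner_sub_mean hp, zero_smul, sub_zero]

lemma inner_toEuclideanCLM_covMat (w : EuclideanSpace ℝ (Fin d)) :
    inner ℝ w (Matrix.toEuclideanCLM (𝕜 := ℝ) (covMat p f) w) =
      ∑ y, p y * inner ℝ (f y - mean p f) w ^ 2 := by
  simp only [toEuclideanCLM_covMat, inner_sum, inner_smul_right, real_inner_comm w, sq]

lemma posSemidef_outerSq (v : EuclideanSpace ℝ (Fin d)) : (outerSq v).PosSemidef := by
  simpa [outerSq_eq_vecMulVec] using Matrix.posSemidef_vecMulVec_self_star (v : Fin d → ℝ)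

lemma posSemidef_covMat (hp : ∀ y, 0 ≤ p y) : (covMat p f).PosSemidef :=
  Matrix.posSemidef_sum _ fun y _ => (posSemidef_outerSq _).smul (hp y)

lemma transpose_covMat : (covMat p f).transpose = covMat p f := by
  simp only [covMat, Matrix.transpose_sum, Matrix.transpose_smul, outerSq_eq_vecMulVec,
    Matrix.transpose_vecMulVec]

lemma outerSq_smul (c : ℝ) (v : EuclideanSpace ℝ (Fin d)) :
    outerSq (c • v) = c ^ 2 • outerSq v := by
  ext i j
  simp only [outerSq, Matrix.of_apply, Matrix.smul_apply, PiLp.smul_apply, smul_eq_mul]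
  ring

lemma mean_smul_sub_const (hp : ∑ y, p y = 1) (c : ℝ) (b : EuclideanSpace ℝ (Fin d)) :
    mean p (fun y => c • (f y - b)) = c • (mean p f - b) := by
  simp only [mean, smul_comm _ c, ← Finset.smul_sum, smul_sub, Finset.sum_sub_distrib,
    ← Finset.sum_smul, hp, one_smul]

lemma covMat_smul_sub_const (hp : ∑ y, p y = 1) (c : ℝ) (b : EuclideanSpace ℝ (Fin d)) :
    covMat p (fun y => c • (f y - b)) = c ^ 2 • covMat p f := by
  simp only [covMat, mean_smul_sub_const hp, ← smul_sub, sub_sub_sub_cancel_right, outerSq_smul,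
    Finset.smul_sum, smul_comm (c ^ 2)]

lemma sum_smul_outerSq_sub_const (hp : ∑ y, p y = 1) (c : EuclideanSpace ℝ (Fin d)) :
    ∑ y, p y • outerSq (f y - c) = covMat p f + outerSq (mean p f - c) := by
  ext i j
  have hmean : ∀ k, mean p f k = ∑ y, p y * f y k := fun k => by simp [mean]
  have hexpand : ∀ y, p y * ((f y i - c i) * (f y j - c j)) =
      p y * ((f y i - mean p f i) * (f y j - mean p f j)) +
        (p y * f y i - p y * mean p f i) * (mean p f j - c j) +
        (p y * f y j - p y * mean p f j) * (mean p f i - c i) +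
        p y * ((mean p f i - c i) * (mean p f j - c j)) := fun y => by ring
  simp only [covMat, outerSq, Matrix.add_apply, Matrix.sum_apply, Matrix.smul_apply,
    Matrix.of_apply, PiLp.sub_apply, smul_eq_mul, hexpand, Finset.sum_add_distrib,
    ← Finset.sum_mul, Finset.sum_sub_distrib, hp, ← hmean]
  ring

lemma eq_zero_of_inner_eq_const (hp : ∑ y, p y = 1) (hdet : IsUnit (covMat p f).det)
    {h : EuclideanSpace ℝ (Fin d)} {c : ℝ} (hc : ∀ y, inner ℝ (f y) h = c) : h = 0 := by
  have hcentred : ∀ y, inner ℝ (f y - mean p f) h = 0 := fun y => by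
    simp [inner_sub_left, inner_mean, hc, ← Finset.sum_mul, hp]
  have hker : (covMat p f).mulVec h = 0 := by
    simp [← Matrix.ofLp_toEuclideanCLM, toEuclideanCLM_covMat, hcentred]
  ext i
  exact congrFun (Matrix.eq_zero_of_mulVec_eq_zero hdet.ne_zero hker) i

end WeightedMoments

section Sampling

lemma identDistrib_of_measureReal_eq {Y Ω Ω' : Type*} [Countable Y] [MeasurableSpace Y]
    [MeasurableSingletonClass Y] [MeasurableSpace Ω] [MeasurableSpace Ω'] {P : Measure Ω}
    {P' : Measure Ω'} [IsFiniteMeasure P] [IsFiniteMeasure P'] {o : Ω → Y} {o' : Ω' → Y}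
    (ho : Measurable o) (ho' : Measurable o')
    (h : ∀ b, P.real {ω | o ω = b} = P'.real {ω | o' ω = b}) :
    IdentDistrib o o' P P' where
  aemeasurable_fst := ho.aemeasurable
  aemeasurable_snd := ho'.aemeasurable
  map_eq := by
    refine ext_iff_measureReal_singleton.2 fun b => ?_
    rw [map_measureReal_apply ho (measurableSet_singleton b),
      map_measureReal_apply ho' (measurableSet_singleton b)]
    exact h b

variable {Y Ω : Type*} [Fintype Y] [MeasurableSpace Y] [MeasurableSingletonClass Y]
  [MeasurableSpace Ω] {P : Measure Ω} {q : Y → ℝ}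

lemma integral_comp_eq_sum [IsFiniteMeasure P] {E : Type*} [NormedAddCommGroup E]
    [NormedSpace ℝ E] [CompleteSpace E] {o : Ω → Y} (ho : Measurable o)
    (hq : ∀ b, P.real {ω | o ω = b} = q b) (f : Y → E) :
    ∫ ω, f (o ω) ∂P = ∑ b, q b • f b := by
  rw [← integral_map ho.aemeasurable (f := f) (StronglyMeasurable.of_discrete).aestronglyMeasurable,
    integral_fintype (.of_finite)]
  refine Finset.sum_congr rfl fun b _ => ?_
  rw [map_measureReal_apply ho (measurableSet_singleton b), ← hq b]
  rfl

variable {d : ℕ}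

lemma variance_inner_comp_eq [IsProbabilityMeasure P] {o : Ω → Y} (ho : Measurable o)
    (hq : ∀ b, P.real {ω | o ω = b} = q b) (f : Y → EuclideanSpace ℝ (Fin d))
    (t : EuclideanSpace ℝ (Fin d)) :
    Var[fun ω => inner ℝ (f (o ω)) t; P] =
      inner ℝ t (Matrix.toEuclideanCLM (𝕜 := ℝ) (covMat q f) t) := by
  have hmeas : Measurable fun ω => inner ℝ (f (o ω)) t :=
    (measurable_of_finite fun b => inner ℝ (f b) t).comp ho
  rw [variance_eq_integral hmeas.aemeasurable,
    integral_comp_eq_sum ho hq fun b => inner ℝ (f b) t,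
    integral_comp_eq_sum ho hq fun b => (inner ℝ (f b) t - _) ^ 2, inner_toEuclideanCLM_covMat]
  simp only [inner_sub_left, inner_mean, smul_eq_mul]

lemma inv_sqrt_smul_sub_smul {E : Type*} [AddCommGroup E] [Module ℝ E] (n : ℕ) (s m : E) :
    (√(n : ℝ))⁻¹ • (s - (n : ℝ) • m) = √(n : ℝ) • ((n : ℝ)⁻¹ • s - m) := by
  rcases eq_or_ne n 0 with rfl | hn
  · simp
  · have hn' : (n : ℝ) ≠ 0 := Nat.cast_ne_zero.2 hn
    rw [← smul_inv_smul₀ hn' s, ← smul_sub, smul_smul, inv_mul_eq_div, Real.div_sqrt,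
      smul_inv_smul₀ hn']

theorem tendstoInDistribution_sqrt_smul_sub_mean [IsProbabilityMeasure P] {o : ℕ → Ω → Y}
    (ho : ∀ i, Measurable (o i)) (hindep : iIndepFun o P)
    (hq : ∀ i b, P.real {ω | o i ω = b} = q b) (f : Y → EuclideanSpace ℝ (Fin d)) :
    TendstoInDistribution
      (fun (n : ℕ) ω => √(n : ℝ) • ((n : ℝ)⁻¹ • ∑ i : Fin n, f (o i ω) - mean q f)) atTop id
      (fun _ => P) (multivariateGaussian 0 (covMat q f)) := by
  have hf : Measurable f := measurable_of_finite f
  have hident : ∀ i, IdentDistrib (o i) (o 0) P P := fun i =>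
    identDistrib_of_measureReal_eq (ho i) (ho 0) fun b => by rw [hq, hq]
  have hmem : MemLp (fun ω => f (o 0 ω)) 2 P :=
    MemLp.comp_of_map (MemLp.of_discrete) (ho 0).aemeasurable
  have hS : (covMat q f).PosSemidef :=
    posSemidef_covMat fun b => (hq 0 b).symm ▸ measureReal_nonneg
  have hclt := tendstoInDistribution_inv_sqrt_smul_sum_sub (X := fun i ω => f (o i ω)) hmem
    (hindep.comp (fun _ => f) fun _ => hf) (fun i => (hident i).comp hf)
    (IsGaussian.hasGaussianLaw_id (μ := multivariateGaussian 0 (covMat q f)))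
    integral_id_multivariateGaussian fun t => (variance_inner_multivariateGaussian 0 hS t).trans
      (variance_inner_comp_eq (ho 0) (hq 0) f t).symm
  refine hclt.congr (fun n => ae_of_all _ fun ω => ?_) (ae_eq_refl _)
  have hmean : ∫ ω, f (o 0 ω) ∂P = mean q f := integral_comp_eq_sum (ho 0) (hq 0) f
  beta_reduce
  rw [hmean, Fin.sum_univ_eq_sum_range fun i => f (o i ω), inv_sqrt_smul_sub_smul]

end Sampling

lemma exists_localInverse_of_isUnit_det {κ : Type*} [Fintype κ] [DecidableEq κ]
    {f : EuclideanSpace ℝ κ → EuclideanSpace ℝ κ} {a : EuclideanSpace ℝ κ} {M : Matrix κ κ ℝ}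
    (hM : IsUnit M.det)
    (hf : HasStrictFDerivAt f (Matrix.toEuclideanCLM (𝕜 := ℝ) M) a) :
    ∃ g : EuclideanSpace ℝ κ → EuclideanSpace ℝ κ, g (f a) = a ∧
      (∀ᶠ b in 𝓝 (f a), f (g b) = b) ∧
      HasFDerivAt g (Matrix.toEuclideanCLM (𝕜 := ℝ) M⁻¹) (f a) := by
  let e := ContinuousLinearEquiv.equivOfInverse (Matrix.toEuclideanCLM (𝕜 := ℝ) M)
    (Matrix.toEuclideanCLM (𝕜 := ℝ) M⁻¹)
    (fun x => by
      rw [← mul_apply_eq_comp, ← map_mul, Matrix.nonsing_inv_mul _ hM, map_one, one_apply_eq_self])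
    (fun x => by
      rw [← mul_apply_eq_comp, ← map_mul, Matrix.mul_nonsing_inv _ hM, map_one, one_apply_eq_self])
  have he : HasStrictFDerivAt f (e : EuclideanSpace ℝ κ →L[ℝ] EuclideanSpace ℝ κ) a := hf
  exact ⟨he.localInverse f e a, he.localInverse_apply_image, he.eventually_right_inverse,
    he.to_localInverse.hasFDerivAt⟩

section ExponentialFamily

variable {Y : Type*} [Fintype Y] {d : ℕ}

lemma expFamily_pos (φ : Y → EuclideanSpace ℝ (Fin d)) (θ : EuclideanSpace ℝ (Fin d)) (y : Y) :
    0 < expFamily φ θ y :=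
  Real.exp_pos _

lemma transpose_inv_fisherInfo (φ : Y → EuclideanSpace ℝ (Fin d))
    (θ : EuclideanSpace ℝ (Fin d)) : ((fisherInfo φ θ)⁻¹).transpose = (fisherInfo φ θ)⁻¹ := by
  rw [Matrix.transpose_nonsing_inv, fisherInfo, transpose_covMat]

variable [Nonempty Y]

lemma sum_exp_inner_pos (φ : Y → EuclideanSpace ℝ (Fin d)) (θ : EuclideanSpace ℝ (Fin d)) :
    0 < ∑ y, Real.exp (inner ℝ (φ y) θ) :=
  Finset.sum_pos (fun _ _ => Real.exp_pos _) Finset.univ_nonempty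

lemma expFamily_eq_div (φ : Y → EuclideanSpace ℝ (Fin d)) (θ : EuclideanSpace ℝ (Fin d)) (y : Y) :
    expFamily φ θ y = Real.exp (inner ℝ (φ y) θ) / ∑ y', Real.exp (inner ℝ (φ y') θ) := by
  rw [expFamily, logPartition, Real.exp_sub, Real.exp_log (sum_exp_inner_pos φ θ)]

lemma sum_expFamily (φ : Y → EuclideanSpace ℝ (Fin d)) (θ : EuclideanSpace ℝ (Fin d)) :
    ∑ y, expFamily φ θ y = 1 := by
  simp_rw [expFamily_eq_div, ← Finset.sum_div]
  exact div_self (sum_exp_inner_pos φ θ).ne'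

lemma exp_logPartition_sub (φ : Y → EuclideanSpace ℝ (Fin d)) (θ θ' : EuclideanSpace ℝ (Fin d)) :
    Real.exp (logPartition φ θ' - logPartition φ θ) =
      ∑ y, expFamily φ θ y * Real.exp (inner ℝ (φ y) (θ' - θ)) := by
  rw [Real.exp_sub, logPartition, logPartition, Real.exp_log (sum_exp_inner_pos φ θ'),
    Real.exp_log (sum_exp_inner_pos φ θ), Finset.sum_div]
  refine Finset.sum_congr rfl fun y _ => ?_
  rw [expFamily_eq_div, inner_sub_right, Real.exp_sub]
  field_simp

lemma inner_mean_le_logPartition_sub (φ : Y → EuclideanSpace ℝ (Fin d))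
    (θ θ' : EuclideanSpace ℝ (Fin d)) :
    inner ℝ (mean (expFamily φ θ) φ) (θ' - θ) ≤ logPartition φ θ' - logPartition φ θ := by
  rw [← Real.exp_le_exp, exp_logPartition_sub, inner_mean]
  exact convexOn_exp.map_sum_le (fun y _ => (expFamily_pos φ θ y).le) (sum_expFamily φ θ)
    fun _ _ => Set.mem_univ _

lemma eq_of_logPartition_sub_eq_inner_mean {φ : Y → EuclideanSpace ℝ (Fin d)}
    {θ₀ θ θ' : EuclideanSpace ℝ (Fin d)} (hI : IsUnit (fisherInfo φ θ₀).det)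
    (h : logPartition φ θ' - logPartition φ θ = inner ℝ (mean (expFamily φ θ) φ) (θ' - θ)) :
    θ' = θ := by
  have hjensen : Real.exp (∑ y, expFamily φ θ y • inner ℝ (φ y) (θ' - θ)) =
      ∑ y, expFamily φ θ y • Real.exp (inner ℝ (φ y) (θ' - θ)) := by
    simp only [smul_eq_mul]
    rw [← exp_logPartition_sub, ← inner_mean, h]
  have hconst := (strictConvexOn_exp.map_sum_eq_iff (fun y _ => expFamily_pos φ θ y)
    (sum_expFamily φ θ) fun _ _ => Set.mem_univ _).1 hjensen
  exact sub_eq_zero.1 (eq_zero_of_inner_eq_const (sum_expFamily φ θ₀) hI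
    fun y => hconst y (Finset.mem_univ y))

theorem isMomentMaximizer_mean_iff {φ : Y → EuclideanSpace ℝ (Fin d)}
    {θ₀ θ θ' : EuclideanSpace ℝ (Fin d)} (hI : IsUnit (fisherInfo φ θ₀).det) :
    IsMomentMaximizer φ (mean (expFamily φ θ) φ) θ' ↔ θ' = θ := by
  constructor
  · intro h
    have hle := h θ
    have hge := inner_mean_le_logPartition_sub φ θ θ'
    refine eq_of_logPartition_sub_eq_inner_mean hI ?_
    rw [inner_sub_right] at hge ⊢
    linarith
  · rintro rfl η
    have hle := inner_mean_le_logPartition_sub φ θ' η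
    rw [inner_sub_right] at hle
    linarith

lemma hasStrictFDerivAt_logPartition (φ : Y → EuclideanSpace ℝ (Fin d))
    (θ : EuclideanSpace ℝ (Fin d)) :
    HasStrictFDerivAt (logPartition φ) (innerSL ℝ (mean (expFamily φ θ) φ)) θ := by
  have hsum : HasStrictFDerivAt (fun θ => ∑ y, Real.exp (inner ℝ (φ y) θ))
      (∑ y, Real.exp (inner ℝ (φ y) θ) • innerSL ℝ (φ y)) θ :=
    HasStrictFDerivAt.fun_sum fun y _ => (innerSL ℝ (φ y)).hasStrictFDerivAt.exp
  refine (hsum.log (sum_exp_inner_pos φ θ).ne').congr_fderiv ?_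
  simp only [mean, expFamily_eq_div, map_sum, map_smul, Finset.smul_sum, smul_smul, div_eq_inv_mul]

lemma hasStrictFDerivAt_expFamily (φ : Y → EuclideanSpace ℝ (Fin d))
    (θ : EuclideanSpace ℝ (Fin d)) (y : Y) :
    HasStrictFDerivAt (fun θ => expFamily φ θ y)
      (expFamily φ θ y • innerSL ℝ (φ y - mean (expFamily φ θ) φ)) θ := by
  rw [map_sub]
  exact ((innerSL ℝ (φ y)).hasStrictFDerivAt.sub (hasStrictFDerivAt_logPartition φ θ)).exp

theorem hasStrictFDerivAt_mean_expFamily (φ : Y → EuclideanSpace ℝ (Fin d))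
    (θ : EuclideanSpace ℝ (Fin d)) :
    HasStrictFDerivAt (fun θ => mean (expFamily φ θ) φ)
      (Matrix.toEuclideanCLM (𝕜 := ℝ) (fisherInfo φ θ)) θ := by
  have hsum : HasStrictFDerivAt (fun θ => mean (expFamily φ θ) φ)
      (∑ y, (expFamily φ θ y • innerSL ℝ (φ y - mean (expFamily φ θ) φ)).smulRight (φ y)) θ :=
    HasStrictFDerivAt.fun_sum fun y _ => (hasStrictFDerivAt_expFamily φ θ y).smul_const (φ y)
  refine hsum.congr_fderiv (ContinuousLinearMap.ext fun w => ?_)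
  simp [fisherInfo, toEuclideanCLM_covMat_eq_sum (sum_expFamily φ θ), smul_smul, inner_sub_left]

end ExponentialFamily

section MomentEstimator

variable {Y : Type*} [Fintype Y] [Nonempty Y] {d : ℕ} {φ : Y → EuclideanSpace ℝ (Fin d)}
  {θ : EuclideanSpace ℝ (Fin d)}

theorem exists_isMomentMaximizer_iff_eq (hI : IsUnit (fisherInfo φ θ).det) :
    ∃ g : EuclideanSpace ℝ (Fin d) → EuclideanSpace ℝ (Fin d), g (mean (expFamily φ θ) φ) = θ ∧
      (∀ᶠ μ in 𝓝 (mean (expFamily φ θ) φ), ∀ η, IsMomentMaximizer φ μ η ↔ η = g μ) ∧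
      HasFDerivAt g (Matrix.toEuclideanCLM (𝕜 := ℝ) (fisherInfo φ θ)⁻¹)
        (mean (expFamily φ θ) φ) := by
  obtain ⟨g, hgθ, hright, hderiv⟩ :=
    exists_localInverse_of_isUnit_det hI (hasStrictFDerivAt_mean_expFamily φ θ)
  refine ⟨g, hgθ, ?_, hderiv⟩
  filter_upwards [hright] with μ hμ η
  rw [← isMomentMaximizer_mean_iff hI, hμ]

variable {ι Ω : Type*} [MeasurableSpace Ω] {P : Measure Ω} [IsProbabilityMeasure P]
  {l : Filter ι} {M : ι → Ω → EuclideanSpace ℝ (Fin d)}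

theorem tendsto_measureReal_existsUnique_isMomentMaximizer (hI : IsUnit (fisherInfo φ θ).det)
    (hM : TendstoInMeasure P M l fun _ => mean (expFamily φ θ) φ) :
    Tendsto (fun i => P.real {ω | ∃! η, IsMomentMaximizer φ (M i ω) η}) l (𝓝 1) := by
  obtain ⟨g, -, hg, -⟩ := exists_isMomentMaximizer_iff_eq hI
  refine tendsto_measureReal_one (tendsto_of_tendsto_of_tendsto_of_le_of_le tendsto_const_nhds
    (tendsto_measure_notMem hM hg) (fun _ => zero_le) fun i => measure_mono fun ω hω h => hω ?_)
  exact ⟨g (M i ω), (h _).2 rfl, fun η => (h η).1⟩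

theorem tendstoInDistribution_smul_sub_of_isMomentMaximizer [l.IsCountablyGenerated]
    (hI : IsUnit (fisherInfo φ θ).det) {r : ι → ℝ} (hr : Tendsto r l atTop)
    {S : Matrix (Fin d) (Fin d) ℝ} (hS : S.PosSemidef) (hMm : ∀ i, AEMeasurable (M i) P)
    (hM : TendstoInDistribution (fun i ω => r i • (M i ω - mean (expFamily φ θ) φ)) l id
      (fun _ => P) (multivariateGaussian 0 S))
    {T : ι → Ω → EuclideanSpace ℝ (Fin d)} (hTm : ∀ i, AEMeasurable (T i) P)
    (hT : ∀ i ω, (∃ η, IsMomentMaximizer φ (M i ω) η) → IsMomentMaximizer φ (M i ω) (T i ω)) :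
    TendstoInDistribution (fun i ω => r i • (T i ω - θ)) l id (fun _ => P)
      (multivariateGaussian 0 ((fisherInfo φ θ)⁻¹ * S * (fisherInfo φ θ)⁻¹)) := by
  obtain ⟨g, hgθ, hg, hderiv⟩ := exists_isMomentMaximizer_iff_eq hI
  have hTg : Tendsto (fun i => P {ω | T i ω ≠ g (M i ω)}) l (𝓝 0) := by
    have hconsistent := tendstoInMeasure_of_tendstoInDistribution_smul_sub hr hM
    refine tendsto_of_tendsto_of_tendsto_of_le_of_le tendsto_const_nhds
      (tendsto_measure_notMem hconsistent hg) (fun _ => zero_le)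
      fun i => measure_mono fun ω hω h => hω ?_
    exact (h _).1 (hT i ω ⟨_, (h _).2 rfl⟩)
  have hdelta := tendstoInDistribution_smul_sub_of_hasFDerivAt hr hMm hM hderiv hTm hTg
  rw [hgθ] at hdelta
  refine tendstoInDistribution_id_of_map_eq hdelta ?_
  simpa only [map_zero, transpose_inv_fisherInfo, id_eq] using
    map_toEuclideanCLM_multivariateGaussian 0 hS (fisherInfo φ θ)⁻¹

end MomentEstimator

section RandomizedResponse

variable {Y : Type*}

/-- The marginal law `∑ y, p y * S(· ∣ y) = ε p + (1 - ε) u` of an observation under classical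
randomized response, when the unobserved label has probability mass function `p`. -/
def obsLaw (ε : ℝ) (u p : Y → ℝ) : Y → ℝ := ε • p + (1 - ε) • u

variable [Fintype Y] {d : ℕ} {ε : ℝ} {u p : Y → ℝ}

lemma sum_mul_supervision [DecidableEq Y] (hp : ∑ a, p a = 1) (b : Y) :
    ∑ a, p a * supervision ε u b a = obsLaw ε u p b := by
  simp [supervision, obsLaw, mul_add, Finset.sum_add_distrib, ← Finset.sum_mul, hp, mul_comm]

lemma measureReal_obs_eq [DecidableEq Y] [MeasurableSpace Y] [MeasurableSingletonClass Y]
    {Ω : Type*} [MeasurableSpace Ω] {P : Measure Ω} [IsFiniteMeasure P] {y o : Ω → Y}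
    (hy : Measurable y) (ho : Measurable o) (hp : ∑ a, p a = 1)
    (hlaw : ∀ a b, P.real {ω | y ω = a ∧ o ω = b} = p a * supervision ε u b a) (b : Y) :
    P.real {ω | o ω = b} = obsLaw ε u p b := by
  have hunion : {ω | o ω = b} = ⋃ a ∈ (Finset.univ : Finset Y), {ω | y ω = a ∧ o ω = b} := by
    ext ω
    simp
  rw [hunion, measureReal_biUnion_finset]
  · simp_rw [hlaw, sum_mul_supervision hp]
  · exact fun a _ a' _ hne => Set.disjoint_left.2 fun ω h h' => hne (h.1.symm.trans h'.1)
  · exact fun a _ => (hy (measurableSet_singleton a)).inter (ho (measurableSet_singleton b))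

lemma sum_obsLaw (hu : ∑ y, u y = 1) (hp : ∑ y, p y = 1) : ∑ y, obsLaw ε u p y = 1 := by
  simp [obsLaw, Finset.sum_add_distrib, ← Finset.mul_sum, hu, hp]

lemma mean_obsLaw (f : Y → EuclideanSpace ℝ (Fin d)) :
    mean (obsLaw ε u p) f = ε • mean p f + (1 - ε) • mean u f := by
  simp [obsLaw, mean, add_smul, mul_smul, Finset.sum_add_distrib, Finset.smul_sum]

theorem mean_obsFun (hε : ε ≠ 0) (hu : ∑ y, u y = 1) (hp : ∑ y, p y = 1)
    (φ : Y → EuclideanSpace ℝ (Fin d)) : mean (obsLaw ε u p) (obsFun φ ε u) = mean p φ := by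
  unfold obsFun
  rw [mean_smul_sub_const (sum_obsLaw hu hp), mean_obsLaw, add_sub_cancel_right,
    inv_smul_smul₀ hε]

lemma covMat_obsLaw (hu : ∑ y, u y = 1) (hp : ∑ y, p y = 1) (f : Y → EuclideanSpace ℝ (Fin d)) :
    covMat (obsLaw ε u p) f = ε • covMat p f + (1 - ε) • covMat u f +
      (ε * (1 - ε)) • outerSq (mean p f - mean u f) := by
  have hmean : mean (obsLaw ε u p) f - mean u f = ε • (mean p f - mean u f) := by
    rw [mean_obsLaw]
    module
  have hmixture : ∑ y, obsLaw ε u p y • outerSq (f y - mean u f) =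
      ε • ∑ y, p y • outerSq (f y - mean u f) + (1 - ε) • covMat u f := by
    simp [obsLaw, covMat, add_smul, mul_smul, Finset.sum_add_distrib, Finset.smul_sum]
  rw [sum_smul_outerSq_sub_const (sum_obsLaw hu hp), sum_smul_outerSq_sub_const hp, hmean,
    outerSq_smul] at hmixture
  rw [eq_sub_of_add_eq hmixture]
  module

variable [Nonempty Y] {φ : Y → EuclideanSpace ℝ (Fin d)} {θ : EuclideanSpace ℝ (Fin d)}

theorem covMat_obsFun (hε : ε ≠ 0) (hu : ∑ y, u y = 1) :
    covMat (obsLaw ε u (expFamily φ θ)) (obsFun φ ε u) = fisherInfo φ θ + lossMat φ ε u θ := by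
  have hp := sum_expFamily φ θ
  unfold obsFun
  rw [covMat_smul_sub_const (sum_obsLaw hu hp), covMat_obsLaw hu hp, lossMat,
    sum_smul_outerSq_sub_const hp, fisherInfo]
  match_scalars <;> field_simp
  ring

lemma asympVar_eq (hI : IsUnit (fisherInfo φ θ).det) (hε : ε ≠ 0) (hu : ∑ y, u y = 1) :
    asympVar φ ε u θ = (fisherInfo φ θ)⁻¹ *
      covMat (obsLaw ε u (expFamily φ θ)) (obsFun φ ε u) * (fisherInfo φ θ)⁻¹ := by
  rw [covMat_obsFun hε hu, asympVar, mul_add, add_mul, Matrix.nonsing_inv_mul _ hI, one_mul]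

end RandomizedResponse

end RandResponse

open RandResponse in
theorem lemma1_general {Y : Type*} [Fintype Y] [MeasurableSpace Y] [MeasurableSingletonClass Y]
    {d : ℕ} (φ : Y → EuclideanSpace ℝ (Fin d)) (θ₀ : EuclideanSpace ℝ (Fin d))
    (hI : IsUnit (fisherInfo φ θ₀).det)
    (u : Y → ℝ) (hu : ∑ y, u y = 1) (ε : ℝ) (hε : ε ≠ 0)
    {Ω : Type*} [MeasurableSpace Ω] (P : Measure Ω) [IsProbabilityMeasure P]
    (o : ℕ → Ω → Y) (ho : ∀ i, Measurable (o i)) (hindep : iIndepFun o P)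
    (hlaw : ∀ i b, P.real {ω | o i ω = b} = obsLaw ε u (expFamily φ θ₀) b)
    (T : (n : ℕ) → (Fin n → Y) → EuclideanSpace ℝ (Fin d))
    (hT : ∀ n, IsMomentEstimator φ ε u n (T n)) :
    (asympVar φ ε u θ₀).PosSemidef ∧
    Tendsto (fun n : ℕ => P.real {ω | ∃! θ, IsMomentMaximizer φ
      (muHat φ ε u (fun i : Fin n => o i ω)) θ}) atTop (𝓝 1) ∧
    TendstoInDistribution
      (fun (n : ℕ) ω => √(n : ℝ) • (T n (fun i => o i ω) - θ₀)) atTop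
      (id : EuclideanSpace ℝ (Fin d) → EuclideanSpace ℝ (Fin d)) (fun _ => P)
      (multivariateGaussian 0 (asympVar φ ε u θ₀)) := by
  have : Nonempty Y := (nonempty_of_isProbabilityMeasure P).map (o 0)
  have hsample : ∀ n (F : (Fin n → Y) → EuclideanSpace ℝ (Fin d)),
      AEMeasurable (fun ω => F fun i => o i ω) P := fun n F =>
    ((measurable_of_finite F).comp (measurable_pi_lambda _ fun i => ho i)).aemeasurable
  have hsqrt : Tendsto (fun n : ℕ => √(n : ℝ)) atTop atTop :=
    Real.tendsto_sqrt_atTop.comp tendsto_natCast_atTop_atTop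
  have hcov : (covMat (obsLaw ε u (expFamily φ θ₀)) (obsFun φ ε u)).PosSemidef :=
    posSemidef_covMat fun b => hlaw 0 b ▸ measureReal_nonneg
  have hclt := tendstoInDistribution_sqrt_smul_sub_mean ho hindep hlaw (obsFun φ ε u)
  rw [mean_obsFun hε hu (sum_expFamily φ θ₀)] at hclt
  rw [asympVar_eq hI hε hu]
  refine ⟨?_, ?_, ?_⟩
  · simpa [transpose_inv_fisherInfo] using hcov.mul_mul_conjTranspose_same (fisherInfo φ θ₀)⁻¹
  · exact tendsto_measureReal_existsUnique_isMomentMaximizer hI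
      (tendstoInMeasure_of_tendstoInDistribution_smul_sub hsqrt hclt)
  · exact tendstoInDistribution_smul_sub_of_isMomentMaximizer hI hsqrt hcov
      (fun n => hsample n (muHat φ ε u)) hclt (fun n => hsample n (T n)) fun n ω => hT n _

theorem lemma1 {Y : Type*} [Fintype Y] [DecidableEq Y] [MeasurableSpace Y]
    [MeasurableSingletonClass Y] {d : ℕ}
    (φ : Y → EuclideanSpace ℝ (Fin d)) (θ₀ : EuclideanSpace ℝ (Fin d))
    (hI : IsUnit (RandResponse.fisherInfo φ θ₀).det)
    (u : Y → ℝ) (hu : u ∈ stdSimplex ℝ Y)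
    (ε : ℝ) (hε0 : 0 < ε) (hε1 : ε ≤ 1)
    {Ω : Type*} [MeasurableSpace Ω] (P : Measure Ω) [IsProbabilityMeasure P]
    (y o : ℕ → Ω → Y) (hy : ∀ i, Measurable (y i)) (ho : ∀ i, Measurable (o i))
    (hindep : iIndepFun (fun i ω => (y i ω, o i ω)) P)
    (hlaw : ∀ i a b, P.real {ω | y i ω = a ∧ o i ω = b} =
      RandResponse.expFamily φ θ₀ a * RandResponse.supervision ε u b a)
    (T : (n : ℕ) → (Fin n → Y) → EuclideanSpace ℝ (Fin d))
    (hT : ∀ n, RandResponse.IsMomentEstimator φ ε u n (T n)) :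
    (RandResponse.asympVar φ ε u θ₀).PosSemidef ∧
    Tendsto (fun n : ℕ => P.real {ω | ∃! θ, RandResponse.IsMomentMaximizer φ
      (RandResponse.muHat φ ε u (fun i : Fin n => o i ω)) θ}) atTop (𝓝 1) ∧
    TendstoInDistribution
      (fun (n : ℕ) ω => √(n : ℝ) • (T n (fun i => o i ω) - θ₀)) atTop
      (id : EuclideanSpace ℝ (Fin d) → EuclideanSpace ℝ (Fin d)) (fun _ => P)
      (multivariateGaussian 0 (RandResponse.asympVar φ ε u θ₀)) := by
  have : Nonempty Y := (nonempty_of_isProbabilityMeasure P).map (o 0)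
  exact lemma1_general φ θ₀ hI u hu.2 ε hε0.ne' P o ho
    (hindep.comp (fun _ => Prod.snd) fun _ => measurable_snd)
    (fun i => RandResponse.measureReal_obs_eq (hy i) (ho i) (RandResponse.sum_expFamily φ θ₀)
      (hlaw i)) T hT
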